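/- Fix $\alpha>1$ and put $x^*=\sqrt{\alpha-1}$ and $\beta^*=\alpha\arctan(x^*)-x^*$. Regard $[0,2\pi)$ as a circle, let $\mathbb P$ be the normalised Lebesgue measure on it, and let $g(\theta)=3\theta \pmod{2\pi}$. For $\beta\in\mathbb R$ and $\sigma\ge 0$ let $$f_{\beta,\sigma,\theta}(x)=\alpha\arctan(x)+\beta+\sigma\cos\theta,\qquad G_{\beta,\sigma}(x,\theta)=(f_{\beta,\sigma,\theta}(x),g(\theta))\quad\text{on }\mathbb R\times[0,2\pi),$$ and $f_{\beta,\sigma,\theta,n}=f_{\beta,\sigma,g^{n-1}(\theta)}\circ\dots\circ f_{\beta,\sigma,\theta}$. Let $$S^+=\{(\beta,\sigma)\in\mathbb R\times[0,\infty):\beta-\sigma\ge-\beta^*\},\quad S^-=\{(\beta,\sigma)\in\mathbb R\times[0,\infty):\beta+\sigma\le\beta^*\},\quad \mathrm A=S^+\cap S^-.$$ Let $\Theta$ be the space of two-sided orbits $\boldsymbol\theta=(\theta_i)_{i\in\mathbb Z}$ of $g$ (so $\theta_{i+1}=g(\theta_i)$ for all $i$), and let $\tilde{\mathbb P}$ be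 the unique probability measure on $\Theta$ all of whose marginals are $\mathbb P$. For $(\beta,\sigma)\in S^+$ and $\boldsymbol\theta\in\Theta$ the set $\bigcap_{n\ge0}f_{\beta,\sigma,\theta_{-n},n}([x^*,\infty])$ is a single point $\{a^+_{\beta,\sigma}(\boldsymbol\theta)\}$; let $\mu^+_{\beta,\sigma}$ be the pushforward of $\tilde{\mathbb P}$ under $\boldsymbol\theta\mapsto(a^+_{\beta,\sigma}(\boldsymbol\theta),\theta_0)$, and let $\mathcal A^+_{\beta,\sigma}$ be its support. The basin of $\mathcal A^+_{\beta,\sigma}$ is the set of points whose trajectory under $G_{\beta,\sigma}$ has distance from $\mathcal A^+_{\beta,\sigma}$ tending to $0$. The basin of a probability measure $\mu$ is the set of points $p$ for which $\frac1N\sum_{n=0}^{N-1}\delta_{G_{\beta,\sigma}^n(p)}$ converges weakly to $\mu$ as $N\to\infty$. An invariant probability measure is physical if its basin has positive Lebesgue measure. **Proposition.** Let $(\beta,\sigma)\in S^+$. 1. There is a set $R\subset[0,2\pi)$ with $\mathbb P(R)=1$ such that every $(x,\theta)$ in the basin of $\mathcal A^+_{\beta,\sigma}$ with $\theta\in R$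 is in the basin of $\mu^+_{\beta,\sigma}$. 2. $\mu^+_{\beta,\sigma}$ is a physical measure. 3. $\mu^+_{\beta,\sigma}$ is an ergodic $G_{\beta,\sigma}$-invariant probability measure with $\theta$-marginal $\mathbb P$ and support contained in $[x^*,\infty)\times[0,2\pi)$, and it is the only $G_{\beta,\sigma}$-invariant probability measure with these marginal and support properties. 4. If $(\beta,\sigma)\in S^+\setminus\mathrm A$, then $\mu^+_{\beta,\sigma}$ is the only $G_{\beta,\sigma}$-invariant probability measure whose $\theta$-marginal is $\mathbb P$. -/

import Mathlib

open MeasureTheory Filter Topology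

namespace ForcedArctan

noncomputable section

/-! ### The space of angles -/

instance fact_two_pi_pos : Fact (0 < 2 * Real.pi) := ⟨Real.two_pi_pos⟩

/-- The interval `[0, 2π)` with its topology as a circle. -/
abbrev Angle : Type := AddCircle (2 * Real.pi)

/-- The cosine of an angle. -/
def cosine : Angle → ℝ := Real.cos_periodic.lift

/-- The tripling map `θ ↦ 3θ (mod 2π)`. -/
def tripling (θ : Angle) : Angle := 3 • θ

/-- The normalised Lebesgue measure on the circle of angles. -/
def angleMeasure : Measure Angle := AddCircle.haarAddCircle

/-! ### The skew-product map -/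

/-- The unforced fibre map `x ↦ α arctan x + β`. -/
def fibre (α β x : ℝ) : ℝ := α * Real.arctan x + β

/-- The fibre map over the angle `θ`, namely `x ↦ α arctan x + β + σ cos θ`. -/
def forcedFibre (α β σ : ℝ) (θ : Angle) (x : ℝ) : ℝ := fibre α (β + σ * cosine θ) x

/-- The `n`-fold composition of the fibre maps over `θ, 3θ, …, 3ⁿ⁻¹θ`. -/
def fibreIter (α β σ : ℝ) (θ : Angle) : ℕ → ℝ → ℝ
  | 0 => id
  | n + 1 => forcedFibre α β σ (tripling^[n] θ) ∘ fibreIter α β σ θ n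

/-- The skew-product map `(x, θ) ↦ (α arctan x + β + σ cos θ, 3θ)`. -/
def skew (α β σ : ℝ) (p : ℝ × Angle) : ℝ × Angle :=
  (forcedFibre α β σ p.2 p.1, tripling p.2)

/-! ### Parameter regions -/

/-- The unique positive `x` with `α / (1 + x²) = 1`. -/
def xStar (α : ℝ) : ℝ := Real.sqrt (α - 1)

/-- The critical value of `β` for the saddle-node bifurcations of `fibre α β`. -/
def betaStar (α : ℝ) : ℝ := α * Real.arctan (xStar α) - xStar α

/-- The region `S⁺` of the parameter space `ℝ × [0, ∞)`. -/
def SPlus (α : ℝ) : Set (ℝ × ℝ) := {q | 0 ≤ q.2 ∧ -betaStar α ≤ q.1 - q.2}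

/-- The region `S⁻` of the parameter space `ℝ × [0, ∞)`. -/
def SMinus (α : ℝ) : Set (ℝ × ℝ) := {q | 0 ≤ q.2 ∧ q.1 + q.2 ≤ betaStar α}

/-- The region `A = S⁺ ∩ S⁻`. -/
def regionA (α : ℝ) : Set (ℝ × ℝ) := SPlus α ∩ SMinus α

/-! ### Two-sided orbits of the tripling map -/

/-- The set of two-sided orbits of the tripling map. -/
def orbits : Set (ℤ → Angle) := {t | ∀ i, t (i + 1) = tripling (t i)}

/-- The orbits as a subgroup of the group of all two-sided sequences of angles. -/
def orbitGroup : AddSubgroup (ℤ → Angle) where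
  carrier := orbits
  zero_mem' := fun i => by simp [tripling]
  add_mem' := fun {a b} ha hb i => by
    simp only [Pi.add_apply, ha i, hb i, tripling, smul_add]
  neg_mem' := fun {a} ha i => by
    simp only [Pi.neg_apply, ha i, tripling, smul_neg]

theorem isClosed_orbitGroup : IsClosed (orbitGroup : Set (ℤ → Angle)) := by
  have : (orbitGroup : Set (ℤ → Angle)) = ⋂ i : ℤ, {t | t (i + 1) = 3 • t i} := by
    ext t
    simp only [Set.mem_iInter, Set.mem_ofPred_eq]
    rfl
  rw [this]
  refine isClosed_iInter fun i => isClosed_eq (continuous_apply _) ?_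
  exact (continuous_nsmul 3).comp (continuous_apply i)

theorem exists_orbit (i : ℤ) (θ : Angle) : ∃ t ∈ orbits, t i = θ := by
  obtain ⟨s, rfl⟩ := QuotientAddGroup.mk_surjective θ
  refine ⟨fun j => (((3 : ℝ) ^ (j - i) * s : ℝ) : Angle), fun j => ?_, ?_⟩
  · show (((3 : ℝ) ^ (j + 1 - i) * s : ℝ) : Angle) = 3 • (((3 : ℝ) ^ (j - i) * s : ℝ) : Angle)
    rw [← AddCircle.coe_nsmul]
    congr 1
    rw [show j + 1 - i = (j - i) + 1 by ring, zpow_add₀ (by norm_num : (3 : ℝ) ≠ 0)]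
    simp only [zpow_one, nsmul_eq_mul]
    push_cast
    ring
  · simp

theorem exists_orbitMeasure : ∃ μ : Measure orbits, IsProbabilityMeasure μ ∧
    ∀ i : ℤ, μ.map (fun t => t.1 i) = angleMeasure := by
  have : CompactSpace orbitGroup := isCompact_iff_compactSpace.mp isClosed_orbitGroup.isCompact
  let ν : Measure orbitGroup := Measure.addHaarMeasure ⊤
  have hν : IsProbabilityMeasure ν := ⟨Measure.addHaarMeasure_self⟩
  let e : orbitGroup → orbits := fun t => ⟨t.1, t.2⟩
  have he : Measurable e := measurable_subtype_coe.subtype_mk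
  refine ⟨ν.map e, Measure.isProbabilityMeasure_map he.aemeasurable, fun i => ?_⟩
  have hi : Measurable (fun t : orbits => t.1 i) :=
    (measurable_pi_apply i).comp measurable_subtype_coe
  rw [Measure.map_map hi he]
  let φ : orbitGroup →+ Angle := (Pi.evalAddMonoidHom (fun _ : ℤ => Angle) i).comp orbitGroup.subtype
  have hφc : Continuous φ := (continuous_apply i).comp continuous_subtype_val
  have hφs : Function.Surjective φ := fun θ => by
    obtain ⟨t, ht, rfl⟩ := exists_orbit i θ
    exact ⟨⟨t, ht⟩, rfl⟩
  have hp : IsProbabilityMeasure (ν.map φ) := Measure.isProbabilityMeasure_map hφc.aemeasurable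
  have hH : (ν.map φ).IsAddHaarMeasure :=
    Measure.isAddHaarMeasure_map_of_isFiniteMeasure ν φ hφc hφs
  have key := Measure.addHaarMeasure_unique (ν.map φ) (⊤ : TopologicalSpace.PositiveCompacts Angle)
  have h1 : (ν.map φ) ((⊤ : TopologicalSpace.PositiveCompacts Angle) : Set Angle) = 1 := by
    simp
  rw [h1, one_smul] at key
  exact key

theorem orbit_apply_add {t : ℤ → Angle} (ht : t ∈ orbits) (i : ℤ) (k : ℕ) :
    t (i + k) = tripling^[k] (t i) := by
  induction k with
  | zero => simp
  | succ k ih =>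
    rw [Function.iterate_succ_apply', ← ih, ← ht (i + k)]
    push_cast
    rw [add_assoc]

theorem orbitMeasure_unique (μ ν : Measure orbits) [IsProbabilityMeasure μ]
    [IsProbabilityMeasure ν] (hμ : ∀ i : ℤ, μ.map (fun t => t.1 i) = angleMeasure)
    (hν : ∀ i : ℤ, ν.map (fun t => t.1 i) = angleMeasure) : μ = ν := by
  have hm : ∀ i : ℤ, Measurable (fun t : orbits => t.1 i) := fun i =>
    (measurable_pi_apply i).comp measurable_subtype_coe
  have htrip : Measurable tripling := (continuous_nsmul 3).measurable
  let C : Set (Set orbits) := {s | ∃ (i : ℤ) (u : Set Angle), MeasurableSet u ∧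
    (fun t : orbits => t.1 i) ⁻¹' u = s}
  have key : ∀ (i : ℤ) (k : ℕ) (u v : Set Angle), MeasurableSet u → MeasurableSet v →
      (fun t : orbits => t.1 i) ⁻¹' u ∩ (fun t : orbits => t.1 (i + k)) ⁻¹' v ∈ C := by
    intro i k u v hu hv
    refine ⟨i, u ∩ (tripling^[k]) ⁻¹' v, hu.inter ((htrip.iterate k) hv), ?_⟩
    ext t
    simp only [Set.mem_preimage, Set.mem_inter_iff, orbit_apply_add t.2 i k]
  refine ext_of_generate_finite C ?_ ?_ ?_ (by simp)
  · apply le_antisymm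
    · have hid : @Measurable orbits (ℤ → Angle) (MeasurableSpace.generateFrom C) _
          (fun t => t.1) := by
        refine @measurable_pi_lambda _ _ _ (MeasurableSpace.generateFrom C) _ _ fun i => ?_
        exact fun u hu => MeasurableSpace.measurableSet_generateFrom ⟨i, u, hu, rfl⟩
      exact hid.comap_le
    · refine MeasurableSpace.generateFrom_le ?_
      rintro _ ⟨i, u, hu, rfl⟩
      exact hm i hu
  · rintro _ ⟨i, u, hu, rfl⟩ _ ⟨j, v, hv, rfl⟩ -
    rcases le_total i j with hij | hij
    · obtain ⟨k, rfl⟩ := Int.le.dest hij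
      exact key i k u v hu hv
    · obtain ⟨k, rfl⟩ := Int.le.dest hij
      rw [Set.inter_comm]
      exact key j k v u hv hu
  · rintro _ ⟨i, u, hu, rfl⟩
    rw [← Measure.map_apply (hm i) hu, ← Measure.map_apply (hm i) hu, hμ, hν]

/-- The natural extension of the normalised Lebesgue measure: there is exactly one probability
measure on the space of two-sided orbits all of whose marginals are the normalised Lebesgue
measure. -/
theorem existsUnique_orbitMeasure : ∃! μ : Measure orbits, IsProbabilityMeasure μ ∧
    ∀ i : ℤ, μ.map (fun t => t.1 i) = angleMeasure := by
  obtain ⟨μ, hμ, hμ'⟩ := exists_orbitMeasure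
  exact ⟨μ, ⟨hμ, hμ'⟩, fun ν hν => by
    have := hν.1
    exact orbitMeasure_unique ν μ hν.2 hμ'⟩

/-- The probability measure on the space of two-sided orbits all of whose marginals are the
normalised Lebesgue measure. -/
def orbitMeasure : Measure orbits := existsUnique_orbitMeasure.choose

theorem orbitMeasure_spec : IsProbabilityMeasure orbitMeasure ∧
    ∀ i : ℤ, orbitMeasure.map (fun t => t.1 i) = angleMeasure :=
  existsUnique_orbitMeasure.choose_spec.1

/-! ### The measure `μ⁺` and the set `𝒜⁺` -/

/-- The intersection over `n` of the images of `[x*, ∞)` under the `n` fibre maps along the past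
of the orbit from time `-n` to time `0`. Each fibre map sends `+∞` (where `arctan` is `π/2`) into
`[x*, ∞)` when `(β, σ) ∈ S⁺`, so that this is also the intersection of the images of
`[x*, ∞]`. -/
def pullbackSet (α β σ : ℝ) (t : orbits) : Set ℝ :=
  ⋂ n : ℕ, fibreIter α β σ (t.1 (-(n : ℤ))) n '' Set.Ici (xStar α)

theorem fibreIter_succ' (α β σ : ℝ) (θ : Angle) (n : ℕ) :
    fibreIter α β σ θ (n + 1) = fibreIter α β σ (tripling θ) n ∘ forcedFibre α β σ θ := by
  induction n with
  | zero => rfl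
  | succ n ih =>
    rw [fibreIter, ih, ← Function.comp_assoc]
    rfl

theorem abs_cosine_le (θ : Angle) : |cosine θ| ≤ 1 := by
  obtain ⟨s, rfl⟩ := QuotientAddGroup.mk_surjective θ
  exact Real.abs_cos_le_one s

theorem forcedFibre_mono {α : ℝ} (hα : 1 < α) (β σ : ℝ) (θ : Angle) :
    Monotone (forcedFibre α β σ θ) := fun a b hab => by
  have := Real.arctan_strictMono.monotone hab
  unfold forcedFibre fibre
  nlinarith

theorem forcedFibre_mem {α β σ : ℝ} (hα : 1 < α) (hS : (β, σ) ∈ SPlus α) (θ : Angle) {x : ℝ}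
    (hx : xStar α ≤ x) : forcedFibre α β σ θ x ∈ Set.Icc (xStar α) (α * (Real.pi / 2) + β + σ) := by
  obtain ⟨h0, h1⟩ := hS
  have hc := abs_le.mp (abs_cosine_le θ)
  have ha := Real.arctan_strictMono.monotone hx
  have hb := (Real.arctan_lt_pi_div_two x).le
  simp only [betaStar] at h0 h1
  constructor <;> simp only [forcedFibre, fibre] <;> nlinarith

/-- The increment of the fibre maps from the point `x*`. -/
def increment (α y : ℝ) : ℝ := α * (Real.arctan (xStar α + y) - Real.arctan (xStar α))

theorem increment_lt {α y : ℝ} (hα : 1 < α) (hy : 0 < y) : increment α y < y := by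
  obtain ⟨c, hc, hc'⟩ := exists_deriv_eq_slope Real.arctan
    (show xStar α < xStar α + y by linarith) Real.continuous_arctan.continuousOn
    Real.differentiable_arctan.differentiableOn
  have hs : 0 ≤ xStar α := Real.sqrt_nonneg _
  have hsq : xStar α ^ 2 = α - 1 := Real.sq_sqrt (by linarith)
  have h1 : α < 1 + c ^ 2 := by nlinarith [hc.1]
  rw [Real.deriv_arctan, show xStar α + y - xStar α = y by ring, eq_div_iff hy.ne'] at hc'
  simp only at hc'
  rw [increment, ← hc', ← mul_assoc, mul_one_div]
  exact mul_lt_of_lt_one_left hy ((div_lt_one (by positivity)).mpr h1)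

theorem increment_mono {α : ℝ} (hα : 1 < α) : Monotone (increment α) := fun a b hab => by
  have := Real.arctan_strictMono.monotone (add_le_add_right hab (xStar α))
  unfold increment
  nlinarith

theorem arctan_sub_le {s a y : ℝ} (hs : 0 ≤ s) (ha : s ≤ a) (hy : 0 ≤ y) :
    Real.arctan (a + y) - Real.arctan a ≤ Real.arctan (s + y) - Real.arctan s := by
  have hd : ∀ x : ℝ, HasDerivAt (fun x => Real.arctan (x + y) - Real.arctan x)
      (1 / (1 + (x + y) ^ 2) * 1 - 1 / (1 + x ^ 2)) x := fun x =>
    (((hasDerivAt_id x).add_const y).arctan).sub (Real.hasDerivAt_arctan x)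
  have hanti : AntitoneOn (fun x => Real.arctan (x + y) - Real.arctan x) (Set.Ici 0) := by
    refine antitoneOn_of_deriv_nonpos (convex_Ici 0)
      (fun x _ => (hd x).continuousAt.continuousWithinAt)
      (fun x _ => (hd x).differentiableAt.differentiableWithinAt) fun x hx => ?_
    rw [interior_Ici, Set.mem_Ioi] at hx
    rw [(hd x).deriv, mul_one, sub_nonpos]
    exact one_div_le_one_div_of_le (by positivity) (by nlinarith)
  exact hanti (Set.mem_Ici.mpr hs) (Set.mem_Ici.mpr (hs.trans ha)) ha

theorem fibreIter_continuous (α β σ : ℝ) (θ : Angle) (n : ℕ) :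
    Continuous (fibreIter α β σ θ n) := by
  induction n with
  | zero => exact continuous_id
  | succ n ih =>
    refine Continuous.comp ?_ ih
    exact (continuous_const.mul Real.continuous_arctan).add continuous_const

theorem fibreIter_le {α β σ : ℝ} (hα : 1 < α) (hS : (β, σ) ∈ SPlus α) (n : ℕ) :
    ∀ (θ : Angle) {a b : ℝ}, xStar α ≤ a → a ≤ b →
      fibreIter α β σ θ n a ≤ fibreIter α β σ θ n b ∧
      fibreIter α β σ θ n b - fibreIter α β σ θ n a ≤ (increment α)^[n] (b - a) := by
  induction n with
  | zero => intro θ a b _ hab; exact ⟨hab, le_rfl⟩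
  | succ n ih =>
    intro θ a b ha hab
    have hm := forcedFibre_mono hα β σ θ hab
    obtain ⟨h1, h2⟩ := ih (tripling θ) (forcedFibre_mem hα hS θ ha).1 hm
    rw [fibreIter_succ', Function.iterate_succ_apply]
    refine ⟨h1, h2.trans ((increment_mono hα).iterate n ?_)⟩
    have := arctan_sub_le (Real.sqrt_nonneg (α - 1)) ha (sub_nonneg.mpr hab)
    rw [add_sub_cancel] at this
    change _ ≤ Real.arctan (xStar α + (b - a)) - Real.arctan (xStar α) at this
    simp only [forcedFibre, fibre, increment]
    nlinarith

theorem tendsto_increment_iterate {α : ℝ} (hα : 1 < α) {c : ℝ} (hc : 0 ≤ c) :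
    Tendsto (fun n : ℕ => (increment α)^[n] c) atTop (𝓝 0) := by
  have h0 : increment α 0 = 0 := by simp [increment]
  have hle : ∀ y, 0 ≤ y → increment α y ≤ y := fun y hy => by
    rcases hy.eq_or_lt with rfl | hy
    · exact h0.le
    · exact (increment_lt hα hy).le
  have hnn : ∀ n : ℕ, 0 ≤ (increment α)^[n] c := fun n => by
    induction n with
    | zero => exact hc
    | succ n ih =>
      rw [Function.iterate_succ_apply', ← h0]
      exact increment_mono hα ih
  have hanti : Antitone fun n : ℕ => (increment α)^[n] c := antitone_nat_of_succ_le fun n => by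
    rw [Function.iterate_succ_apply']
    exact hle _ (hnn n)
  have hlim := tendsto_atTop_ciInf hanti ⟨0, by rintro _ ⟨n, rfl⟩; exact hnn n⟩
  set l := ⨅ n : ℕ, (increment α)^[n] c
  have hcont : Continuous (increment α) :=
    continuous_const.mul ((Real.continuous_arctan.comp (continuous_const.add continuous_id)).sub
      continuous_const)
  have hfix : increment α l = l := isFixedPt_of_tendsto_iterate hlim hcont.continuousAt
  have hl : 0 ≤ l := le_ciInf hnn
  rcases hl.eq_or_lt with hl | hl
  · rwa [← hl] at hlim
  · exact absurd hfix (increment_lt hα hl).ne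

/-- For parameters in `S⁺` the intersection is a single point. -/
theorem exists_pullbackSet_eq {α β σ : ℝ} (hα : 1 < α) (hS : (β, σ) ∈ SPlus α) (t : orbits) :
    ∃ a, pullbackSet α β σ t = {a} := by
  set M := α * (Real.pi / 2) + β + σ with hM
  have hxM : xStar α ≤ M :=
    (forcedFibre_mem hα hS 0 le_rfl).1.trans (forcedFibre_mem hα hS 0 le_rfl).2
  have hstep : ∀ (n : ℕ) (x : ℝ), fibreIter α β σ (t.1 (-((n + 1 : ℕ) : ℤ))) (n + 1) x =
      fibreIter α β σ (t.1 (-(n : ℤ))) n (forcedFibre α β σ (t.1 (-((n + 1 : ℕ) : ℤ))) x) := by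
    intro n x
    rw [fibreIter_succ', ← t.2 (-((n + 1 : ℕ) : ℤ))]
    rw [show -((n + 1 : ℕ) : ℤ) + 1 = -(n : ℤ) by push_cast; ring]
    rfl
  let K : ℕ → Set ℝ := fun n => fibreIter α β σ (t.1 (-(n : ℤ))) n '' Set.Icc (xStar α) M
  have hSK : ∀ n, fibreIter α β σ (t.1 (-((n + 1 : ℕ) : ℤ))) (n + 1) '' Set.Ici (xStar α) ⊆ K n := by
    rintro n _ ⟨x, hx, rfl⟩
    exact ⟨_, forcedFibre_mem hα hS _ hx, (hstep n x).symm⟩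
  have hKS : ∀ n, K n ⊆ fibreIter α β σ (t.1 (-(n : ℤ))) n '' Set.Ici (xStar α) := fun n =>
    Set.image_mono fun x hx => hx.1
  have hKc : ∀ n, IsCompact (K n) := fun n =>
    isCompact_Icc.image (fibreIter_continuous _ _ _ _ _)
  obtain ⟨a, ha⟩ := IsCompact.nonempty_iInter_of_sequence_nonempty_isCompact_isClosed K
    (fun n => (hKS (n + 1)).trans (hSK n)) (fun n => (Set.nonempty_Icc.mpr hxM).image _) (hKc 0)
    (fun n => (hKc n).isClosed)
  have ha' : ∀ n, a ∈ K n := Set.mem_iInter.mp ha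
  have hdist : ∀ p q : ℝ, (∀ n, p ∈ K n) → (∀ n, q ∈ K n) → p ≤ q → p = q := by
    intro p q hp hq hpq
    have hb : ∀ n : ℕ, q - p ≤ (increment α)^[n] (M - xStar α) := fun n => by
      obtain ⟨x, hx, hxp⟩ := hp n
      obtain ⟨y, hy, hyq⟩ := hq n
      obtain ⟨h1, -⟩ := fibreIter_le hα hS n (t.1 (-(n : ℤ))) le_rfl hx.1
      obtain ⟨h2, -⟩ := fibreIter_le hα hS n (t.1 (-(n : ℤ))) hy.1 hy.2
      obtain ⟨-, h3⟩ := fibreIter_le hα hS n (t.1 (-(n : ℤ))) le_rfl hxM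
      linarith
    have := ge_of_tendsto' (tendsto_increment_iterate hα (sub_nonneg.mpr hxM)) hb
    linarith
  refine ⟨a, Set.eq_singleton_iff_unique_mem.mpr
    ⟨Set.mem_iInter.mpr fun n => hKS n (ha' n), fun b hb => ?_⟩⟩
  have hb' : ∀ n, b ∈ K n := fun n => hSK n (Set.mem_iInter.mp hb (n + 1))
  rcases le_total a b with h | h
  · exact (hdist a b ha' hb' h).symm
  · exact hdist b a hb' ha' h

/-- The number `a⁺` attached to a two-sided orbit: the only element of `pullbackSet`. -/
def aPlus (α β σ : ℝ) (t : orbits) : ℝ :=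
  Classical.epsilon fun a => pullbackSet α β σ t = {a}

theorem pullbackSet_eq {α β σ : ℝ} (hα : 1 < α) (hS : (β, σ) ∈ SPlus α) (t : orbits) :
    pullbackSet α β σ t = {aPlus α β σ t} :=
  Classical.epsilon_spec (exists_pullbackSet_eq hα hS t)

/-- The measure `μ⁺`: the law of `(a⁺(t), t₀)` for a random two-sided orbit `t`. -/
def muPlus (α β σ : ℝ) : Measure (ℝ × Angle) :=
  orbitMeasure.map fun t => (aPlus α β σ t, t.1 0)

/-- The set `𝒜⁺`: the support of `μ⁺`. -/
def attractorPlus (α β σ : ℝ) : Set (ℝ × Angle) := (muPlus α β σ).support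

/-! ### Basins and physical measures -/

/-- The basin of a (non-empty compact) set `A`: the points whose trajectory has distance from `A`
tending to `0`. -/
def basin (G : ℝ × Angle → ℝ × Angle) (A : Set (ℝ × Angle)) : Set (ℝ × Angle) :=
  {p | Tendsto (fun n : ℕ => Metric.infDist (G^[n] p) A) atTop (𝓝 0)}

/-- The empirical measure of the first `N` points of the trajectory of `p`. -/
def empirical (G : ℝ × Angle → ℝ × Angle) (p : ℝ × Angle) (N : ℕ) : Measure (ℝ × Angle) :=
  (N : ENNReal)⁻¹ • ∑ n ∈ Finset.range N, Measure.dirac (G^[n] p)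

/-- The basin of a measure `μ`: the points whose empirical measures converge weakly to `μ`, that
is, against all bounded continuous functions. -/
def measureBasin (G : ℝ × Angle → ℝ × Angle) (μ : Measure (ℝ × Angle)) : Set (ℝ × Angle) :=
  {p | ∀ h : BoundedContinuousFunction (ℝ × Angle) ℝ,
    Tendsto (fun N : ℕ => ∫ q, h q ∂(empirical G p N)) atTop (𝓝 (∫ q, h q ∂μ))}

/-- `μ` is a physical measure: an invariant probability measure whose basin has positive Lebesgue
measure. -/
def IsPhysical (G : ℝ × Angle → ℝ × Angle) (μ : Measure (ℝ × Angle)) : Prop :=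
  IsProbabilityMeasure μ ∧ MeasurePreserving G μ μ ∧ 0 < volume (measureBasin G μ)

end

end ForcedArctan

namespace ForcedArctan

noncomputable section

/-! ### Equidistribution of almost every orbit of the tripling map -/

/-! Everything reduces to one fact: if the tripling orbit of `θ` is equidistributed and the
trajectory of `(x, θ)` ever reaches `x ≥ x*`, then `(x, θ)` is in the basin of `μ⁺`
(`mem_measureBasin_of_le_fibreIter`). Above `x*` the fibre maps contract uniformly over all angles,
so for large `k` an observable `h ∘ G^k` is uniformly close on the trapping interval to a function
of `θ` alone, `h (G^k (x*, θ))`. Equidistribution gives the limit of the averages of that function,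
and invariance of `μ⁺` shows that this limit is close to `∫ h dμ⁺`.

Almost every angle is equidistributed: the characters along the orbit are orthonormal in `L²`, which
gives almost sure convergence of averages along squares, then along all `N`, and then for all
continuous functions by density of trigonometric polynomials.

The basin of `μ⁺` thus contains almost all of `[x*, ∞) × circle`, so `μ⁺` is physical. An invariant
probability measure concentrated on this basin equals `μ⁺` (`eq_of_ae_mem_measureBasin`). This gives
uniqueness and, applied to `μ⁺` conditioned on an invariant set, ergodicity.

It remains to show that certain trajectories reach `x*`. A trajectory attracted to `𝒜⁺` from
strictly below would converge to `x*`, which makes the forcing converge; equidistribution then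
leaves only `σ = 0`, `β = -β*`, where `x*` repels from below. Outside `A` one has `β + σ > β*`, and
the angle lingers near `0` long enough for the forcing to push any point up past `x*`. -/

instance : IsProbabilityMeasure angleMeasure :=
  inferInstanceAs (IsProbabilityMeasure AddCircle.haarAddCircle)

theorem continuous_tripling : Continuous tripling := continuous_nsmul 3

theorem tripling_iterate (n : ℕ) (θ : Angle) : tripling^[n] θ = (3 ^ n : ℕ) • θ := by
  induction n with
  | zero => simp
  | succ n ih => rw [Function.iterate_succ_apply', ih, tripling, smul_smul, pow_succ']

/-- Averages of a bounded sequence tend to zero if they do so along the squares. -/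
theorem tendsto_average_of_squares {u : ℕ → ℂ} (hu : ∀ n, ‖u n‖ ≤ 1)
    (h : Tendsto (fun k : ℕ => ((k ^ 2 : ℕ) : ℝ)⁻¹ • ∑ n ∈ Finset.range (k ^ 2), u n) atTop (𝓝 0)) :
    Tendsto (fun N : ℕ => (N : ℝ)⁻¹ • ∑ n ∈ Finset.range N, u n) atTop (𝓝 0) := by
  have hs : Tendsto Nat.sqrt atTop atTop := by
    refine tendsto_atTop.mpr fun b => ?_
    filter_upwards [eventually_ge_atTop (b ^ 2)] with n hn
    exact Nat.le_sqrt'.mpr hn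
  have h2 : Tendsto (fun k : ℕ => ‖((k ^ 2 : ℕ) : ℝ)⁻¹ • ∑ n ∈ Finset.range (k ^ 2), u n‖ +
      2 / (k : ℝ)) atTop (𝓝 0) := by
    have := h.norm.add (tendsto_const_div_atTop_nhds_zero_nat (2 : ℝ))
    simpa using this
  refine squeeze_zero_norm' ?_ (h2.comp hs)
  filter_upwards [eventually_ge_atTop 1] with N hN
  set k := Nat.sqrt N with hk
  have hk1 : 1 ≤ k := Nat.le_sqrt'.mpr (by simpa using hN)
  have hkN : k ^ 2 ≤ N := Nat.sqrt_le' N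
  -- Consecutive squares differ by `2k + 1`, so at most `2k` terms follow the last square; they
  -- contribute at most `2k / k² = 2 / k` to the average.
  have hNk : N ≤ k ^ 2 + 2 * k := by
    have := Nat.lt_succ_sqrt' N
    rw [← hk] at this
    simp only [Nat.succ_eq_add_one] at this
    nlinarith
  have hsum : ‖∑ n ∈ Finset.range N, u n‖ ≤ ‖∑ n ∈ Finset.range (k ^ 2), u n‖ + 2 * k := by
    rw [← Finset.sum_range_add_sum_Ico _ hkN]
    refine (norm_add_le _ _).trans (add_le_add_right ?_ _)
    refine (norm_sum_le_of_le _ fun n _ => hu n).trans ?_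
    simp only [Finset.sum_const, Nat.card_Ico, nsmul_eq_mul, mul_one]
    have : N - k ^ 2 ≤ 2 * k := by omega
    exact_mod_cast this
  have hk0 : (0 : ℝ) < k := by exact_mod_cast hk1
  have hkN' : ((k ^ 2 : ℕ) : ℝ) ≤ N := by exact_mod_cast hkN
  simp only [Function.comp]
  rw [norm_smul, norm_smul, norm_inv, norm_inv, Real.norm_natCast, Real.norm_natCast]
  have hk2 : (0 : ℝ) < ((k ^ 2 : ℕ) : ℝ) := by positivity
  calc (N : ℝ)⁻¹ * ‖∑ n ∈ Finset.range N, u n‖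
      ≤ ((k ^ 2 : ℕ) : ℝ)⁻¹ * (‖∑ n ∈ Finset.range (k ^ 2), u n‖ + 2 * k) := by gcongr
    _ = _ := by
      rw [mul_add]
      congr 1
      rw [← hk]
      push_cast
      field_simp

theorem integral_fourier (m : ℤ) :
    ∫ θ, fourier m θ ∂angleMeasure = if m = 0 then 1 else 0 := by
  have h := fourierCoeff_fourier (T := 2 * Real.pi) m
  have h0 := congrFun h 0
  simp only [fourierCoeff, neg_zero, fourier_zero, one_smul] at h0
  rw [angleMeasure, h0, Pi.single_apply]
  simp [eq_comm]

theorem integrable_of_continuous {E : Type*} [NormedAddCommGroup E] {φ : Angle → E}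
    (h : Continuous φ) : Integrable φ angleMeasure :=
  h.integrable_of_hasCompactSupport (HasCompactSupport.of_compactSpace φ)

/-- Composing the character of frequency `m` with the `n`-th iterate gives frequency `m * 3 ^ n`.
These are distinct for `m ≠ 0`, so this is Pythagoras for orthonormal functions. -/
theorem integral_norm_sq_sum_fourier {m : ℤ} (hm : m ≠ 0) (N : ℕ) :
    ∫ θ, ‖∑ n ∈ Finset.range N, fourier m (tripling^[n] θ)‖ ^ 2 ∂angleMeasure = N := by
  have hf : ∀ (n : ℕ) (θ : Angle), fourier m (tripling^[n] θ) = fourier (m * 3 ^ n) θ := by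
    intro n θ
    rw [tripling_iterate, fourier_apply, fourier_apply, ← natCast_zsmul, smul_smul]
    push_cast
    rfl
  have hpt : ∀ θ : Angle, ((‖∑ n ∈ Finset.range N, fourier m (tripling^[n] θ)‖ ^ 2 : ℝ) : ℂ) =
      ∑ i ∈ Finset.range N, ∑ j ∈ Finset.range N, fourier (m * 3 ^ i + -(m * 3 ^ j)) θ := by
    intro θ
    push_cast
    rw [← Complex.mul_conj', map_sum, Finset.sum_mul_sum]
    simp only [hf, fourier_add, fourier_neg]
  have hint : ∀ k : ℤ, Integrable (fun θ : Angle => fourier k θ) angleMeasure := fun k =>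
    integrable_of_continuous (fourier k).continuous
  have := integral_ofReal (𝕜 := ℂ) (μ := angleMeasure)
    (f := fun θ => ‖∑ n ∈ Finset.range N, fourier m (tripling^[n] θ)‖ ^ 2)
  apply Complex.ofReal_injective
  refine this.symm.trans ?_
  refine (integral_congr_ae (Eventually.of_forall hpt)).trans ?_
  rw [integral_finsetSum _ fun i _ => integrable_finsetSum _ fun j _ => hint _]
  simp_rw [integral_finsetSum _ fun j _ => hint _, integral_fourier]
  have : ∀ i j : ℕ, m * 3 ^ i + -(m * 3 ^ j) = 0 ↔ i = j := by
    intro i j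
    rw [← sub_eq_add_neg, ← mul_sub, mul_eq_zero, or_iff_right hm, sub_eq_zero]
    exact (Int.pow_right_injective (by norm_num : 1 < Int.natAbs 3)).eq_iff
  simp_rw [this, Finset.sum_ite_eq]
  rw [Finset.sum_congr rfl fun i hi => if_pos hi]
  simp

/-- The average over `k²` terms has squared `L²` norm `1 / k²`, which is summable in `k`. Hence the
sum of the squared averages is finite almost everywhere, and its terms tend to zero. -/
theorem ae_tendsto_average_fourier {m : ℤ} (hm : m ≠ 0) :
    ∀ᵐ θ ∂angleMeasure, Tendsto (fun N : ℕ => (N : ℝ)⁻¹ •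
      ∑ n ∈ Finset.range N, fourier m (tripling^[n] θ)) atTop (𝓝 0) := by
  let S : ℕ → Angle → ℂ := fun N θ => (N : ℝ)⁻¹ • ∑ n ∈ Finset.range N, fourier m (tripling^[n] θ)
  have hS : ∀ N, Continuous (S N) := fun N => by
    have hc : Continuous fun θ => ∑ n ∈ Finset.range N, fourier m (tripling^[n] θ) :=
      continuous_finsetSum _ fun n _ =>
        (fourier m).continuous.comp (continuous_tripling.iterate n)
    exact hc.const_smul ((N : ℝ)⁻¹)
  have hint : ∀ k : ℕ, ∫⁻ θ, ENNReal.ofReal (‖S (k ^ 2) θ‖ ^ 2) ∂angleMeasure =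
      ENNReal.ofReal (1 / (k : ℝ) ^ 2) := by
    intro k
    have hi : Integrable (fun θ => ‖S (k ^ 2) θ‖ ^ 2) angleMeasure :=
      integrable_of_continuous ((hS _).norm.pow 2)
    rw [← ofReal_integral_eq_lintegral_ofReal hi (Eventually.of_forall fun θ => sq_nonneg _)]
    simp only [S, norm_smul, mul_pow, integral_const_mul, integral_norm_sq_sum_fourier hm]
    congr 1
    rcases eq_or_ne k 0 with rfl | hk
    · simp
    · have : (k : ℝ) ≠ 0 := by exact_mod_cast hk
      simp only [norm_inv, Real.norm_natCast]
      push_cast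
      field_simp
  have hmeas : ∀ k : ℕ, Measurable fun θ => ENNReal.ofReal (‖S (k ^ 2) θ‖ ^ 2) := fun k =>
    ((hS _).norm.pow 2).measurable.ennreal_ofReal
  have hfin : ∫⁻ θ, ∑' k : ℕ, ENNReal.ofReal (‖S (k ^ 2) θ‖ ^ 2) ∂angleMeasure ≠ ⊤ := by
    rw [lintegral_tsum fun k => (hmeas k).aemeasurable]
    simp_rw [hint]
    exact (Real.summable_one_div_nat_pow.mpr one_lt_two).tsum_ofReal_ne_top
  filter_upwards [ae_lt_top (Measurable.tsum hmeas) hfin] with θ hθ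
  refine tendsto_average_of_squares (fun n => ?_) ?_
  · rw [fourier_apply, Circle.norm_coe]
  · have h0 := ENNReal.tendsto_atTop_zero_of_tsum_ne_top hθ.ne
    have h1 := (ENNReal.tendsto_toReal ENNReal.zero_ne_top).comp h0
    simp only [Function.comp_def, ENNReal.toReal_zero] at h1
    have h2 := h1.sqrt
    simp only [Real.sqrt_zero] at h2
    refine tendsto_zero_iff_norm_tendsto_zero.mpr (h2.congr fun k => ?_)
    rw [ENNReal.toReal_ofReal (by positivity), Real.sqrt_sq (norm_nonneg _)]

/-- The Birkhoff averages of all continuous functions along the orbit of `θ` converge to the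
space average. -/
def Equidistributed (θ : Angle) : Prop :=
  ∀ φ : Angle → ℝ, Continuous φ → Tendsto (fun N : ℕ => (N : ℝ)⁻¹ *
    ∑ n ∈ Finset.range N, φ (tripling^[n] θ)) atTop (𝓝 (∫ s, φ s ∂angleMeasure))

theorem norm_average_le {E : Type*} [NormedAddCommGroup E] [NormedSpace ℝ E] {u : ℕ → E} {c : ℝ}
    (hc : 0 ≤ c) (hu : ∀ n, ‖u n‖ ≤ c) (N : ℕ) :
    ‖(N : ℝ)⁻¹ • ∑ n ∈ Finset.range N, u n‖ ≤ c := by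
  rw [norm_smul, norm_inv, Real.norm_natCast]
  have h := norm_sum_le_of_le (Finset.range N) fun n _ => hu n
  simp only [Finset.sum_const, Finset.card_range, nsmul_eq_mul] at h
  calc (N : ℝ)⁻¹ * ‖∑ n ∈ Finset.range N, u n‖ ≤ (N : ℝ)⁻¹ * (N * c) := by gcongr
    _ ≤ c := by
      rw [← mul_assoc]
      exact mul_le_of_le_one_left hc inv_mul_le_one

/-- Only countably many characters have to be handled almost surely. For a fixed good `θ`, the
functions whose averages converge to their integral form a closed subspace that contains all
characters, hence everything. -/
theorem ae_equidistributed : ∀ᵐ θ ∂angleMeasure, Equidistributed θ := by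
  have h0 : ∀ᵐ θ ∂angleMeasure, ∀ m : ℤ, m ≠ 0 → Tendsto (fun N : ℕ => (N : ℝ)⁻¹ •
      ∑ n ∈ Finset.range N, fourier m (tripling^[n] θ)) atTop (𝓝 0) := by
    refine ae_all_iff.mpr fun m => ?_
    by_cases hm : m = 0
    · simp [hm]
    · filter_upwards [ae_tendsto_average_fourier hm] with θ hθ _
      exact hθ
  filter_upwards [h0] with θ hθ
  let A : C(Angle, ℂ) → ℕ → ℂ := fun φ N =>
    (N : ℝ)⁻¹ • ∑ n ∈ Finset.range N, φ (tripling^[n] θ)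
  let V : Submodule ℂ C(Angle, ℂ) :=
    { carrier := {φ | Tendsto (A φ) atTop (𝓝 (∫ s, φ s ∂angleMeasure))}
      zero_mem' := by simp [A]
      add_mem' := fun {φ ψ} hφ hψ => by
        have := Tendsto.add (Set.mem_ofPred_eq.mp hφ) (Set.mem_ofPred_eq.mp hψ)
        rw [← integral_add (integrable_of_continuous φ.continuous)
          (integrable_of_continuous ψ.continuous)] at this
        refine this.congr fun N => ?_
        simp only [A, ContinuousMap.add_apply, Finset.sum_add_distrib, smul_add]
      smul_mem' := fun c φ hφ => by
        have := (Set.mem_ofPred_eq.mp hφ).const_smul c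
        rw [← integral_smul] at this
        refine this.congr fun N => ?_
        simp only [A, ContinuousMap.smul_apply, ← Finset.smul_sum]
        rw [smul_comm] }
  have hVc : IsClosed (V : Set C(Angle, ℂ)) := by
    refine isClosed_of_closure_subset fun φ hφ => Metric.tendsto_atTop.mpr fun ε hε => ?_
    obtain ⟨ψ, hψ, hd⟩ := Metric.mem_closure_iff.mp hφ (ε / 3) (by positivity)
    obtain ⟨N₀, hN₀⟩ := Metric.tendsto_atTop.mp (show Tendsto (A ψ) atTop _ from hψ) (ε / 3)
      (by positivity)
    have hpt : ∀ s, ‖φ s - ψ s‖ ≤ ε / 3 := fun s => by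
      rw [← dist_eq_norm]
      exact (ContinuousMap.dist_apply_le_dist s).trans hd.le
    refine ⟨N₀, fun N hN => ?_⟩
    have h1 : dist (A φ N) (A ψ N) ≤ ε / 3 := by
      rw [dist_eq_norm, ← smul_sub, ← Finset.sum_sub_distrib]
      exact norm_average_le (by positivity) (fun n => hpt _) N
    have h2 : dist (∫ s, ψ s ∂angleMeasure) (∫ s, φ s ∂angleMeasure) ≤ ε / 3 := by
      rw [dist_comm, dist_eq_norm, ← integral_sub (integrable_of_continuous φ.continuous)
          (integrable_of_continuous ψ.continuous)]
      refine (norm_integral_le_of_norm_le_const (Eventually.of_forall hpt)).trans ?_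
      simp
    have h3 := hN₀ N hN
    have h4 := dist_triangle4 (A φ N) (A ψ N) (∫ s, ψ s ∂angleMeasure) (∫ s, φ s ∂angleMeasure)
    linarith
  have hV : V = ⊤ := by
    rw [eq_top_iff, ← span_fourier_closure_eq_top (T := 2 * Real.pi)]
    refine Submodule.topologicalClosure_minimal _ (Submodule.span_le.mpr ?_) hVc
    rintro _ ⟨m, rfl⟩
    show Tendsto (A (fourier m)) atTop (𝓝 (∫ s, fourier m s ∂angleMeasure))
    rw [integral_fourier]
    by_cases hm : m = 0
    · rw [if_pos hm]
      refine tendsto_const_nhds.congr' ?_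
      filter_upwards [eventually_ge_atTop 1] with N hN
      have : (N : ℂ) ≠ 0 := by exact_mod_cast (by omega : N ≠ 0)
      simp [A, hm, this]
    · rw [if_neg hm]
      exact hθ m hm
  intro φ hφ
  have hmem : (⟨fun s => (φ s : ℂ), Complex.continuous_ofReal.comp hφ⟩ : C(Angle, ℂ)) ∈ V :=
    hV ▸ Submodule.mem_top
  have h1 := (Complex.continuous_re.tendsto _).comp
    (show Tendsto (A ⟨fun s => (φ s : ℂ), Complex.continuous_ofReal.comp hφ⟩) atTop
      (𝓝 (∫ s, (φ s : ℂ) ∂angleMeasure)) from hmem)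
  rw [integral_complex_ofReal, Complex.ofReal_re] at h1
  refine h1.congr fun N => ?_
  simp only [Function.comp, A, ContinuousMap.coe_mk, Complex.real_smul]
  rw [← Complex.ofReal_sum, ← Complex.ofReal_mul, Complex.ofReal_re]

/-! ### The skew product -/

theorem continuous_cosine : Continuous cosine :=
  (QuotientAddGroup.isQuotientMap_mk (N := AddSubgroup.zmultiples (2 * Real.pi))).continuous_iff.mpr
    Real.continuous_cos

theorem continuous_skew (α β σ : ℝ) : Continuous (skew α β σ) := by
  refine Continuous.prodMk ?_ (continuous_tripling.comp continuous_snd)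
  have := continuous_cosine.comp (continuous_snd (X := ℝ) (Y := Angle))
  have h2 := Real.continuous_arctan.comp (continuous_fst (X := ℝ) (Y := Angle))
  exact (continuous_const.mul h2).add (continuous_const.add (continuous_const.mul this))

theorem skew_iterate (α β σ : ℝ) (n : ℕ) (x : ℝ) (θ : Angle) :
    (skew α β σ)^[n] (x, θ) = (fibreIter α β σ θ n x, tripling^[n] θ) := by
  induction n with
  | zero => rfl
  | succ n ih =>
    rw [Function.iterate_succ_apply', ih, Function.iterate_succ_apply']
    rfl

theorem continuous_fibreIter_base (α β σ : ℝ) (n : ℕ) (x : ℝ) :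
    Continuous fun θ => fibreIter α β σ θ n x := by
  have := continuous_fst.comp
    (((continuous_skew α β σ).iterate n).comp (Continuous.prodMk_right x))
  refine this.congr fun θ => ?_
  simp only [Function.comp, skew_iterate]

/-- The interval that contains the images of `[x*, ∞)` under all the fibre maps. -/
def trap (α β σ : ℝ) : Set ℝ := Set.Icc (xStar α) (α * (Real.pi / 2) + β + σ)

theorem measurable_orbit_apply (i : ℤ) : Measurable fun t : orbits => t.1 i :=
  (measurable_pi_apply i).comp measurable_subtype_coe

section SPlus

variable {α β σ : ℝ} (hα : 1 < α) (hS : (β, σ) ∈ SPlus α)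

include hα hS

theorem xStar_mem_trap : xStar α ∈ trap α β σ :=
  ⟨le_rfl, (forcedFibre_mem hα hS 0 le_rfl).1.trans (forcedFibre_mem hα hS 0 le_rfl).2⟩

theorem fibreIter_mem_trap (θ : Angle) (n : ℕ) {x : ℝ} (hx : x ∈ trap α β σ) :
    fibreIter α β σ θ n x ∈ trap α β σ := by
  induction n with
  | zero => exact hx
  | succ n ih => exact forcedFibre_mem hα hS _ ih.1

theorem abs_fibreIter_sub_le (θ : Angle) (n : ℕ) {x : ℝ} (hx : x ∈ trap α β σ) :
    |fibreIter α β σ θ n x - fibreIter α β σ θ n (xStar α)| ≤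
      (increment α)^[n] (α * (Real.pi / 2) + β + σ - xStar α) := by
  obtain ⟨h1, h2⟩ := fibreIter_le hα hS n θ le_rfl hx.1
  rw [abs_of_nonneg (sub_nonneg.mpr h1)]
  exact h2.trans ((increment_mono hα).iterate n (sub_le_sub_right hx.2 _))

/-- Over each angle, an observable forgets the starting point in `trap α β σ`, uniformly. -/
theorem exists_forall_abs_sub_le {h : ℝ × Angle → ℝ} (hh : Continuous h) {ε : ℝ} (hε : 0 < ε) :
    ∃ k : ℕ, ∀ x ∈ trap α β σ, ∀ θ : Angle,
      |h ((skew α β σ)^[k] (x, θ)) - h ((skew α β σ)^[k] (xStar α, θ))| ≤ ε := by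
  have hK : IsCompact (trap α β σ ×ˢ (Set.univ : Set Angle)) := isCompact_Icc.prod isCompact_univ
  obtain ⟨δ, hδ, H⟩ := Metric.uniformContinuousOn_iff.mp
    (hK.uniformContinuousOn_of_continuous hh.continuousOn) ε hε
  have ht := tendsto_increment_iterate hα (sub_nonneg.mpr (xStar_mem_trap hα hS).2)
  obtain ⟨k, hk⟩ := (ht.eventually (gt_mem_nhds hδ)).exists
  refine ⟨k, fun x hx θ => ?_⟩
  rw [skew_iterate, skew_iterate, ← Real.dist_eq]
  refine (H _ ⟨fibreIter_mem_trap hα hS θ k hx, trivial⟩ _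
    ⟨fibreIter_mem_trap hα hS θ k (xStar_mem_trap hα hS), trivial⟩ ?_).le
  rw [Prod.dist_eq, dist_self, max_lt_iff, Real.dist_eq]
  exact ⟨(abs_fibreIter_sub_le hα hS θ k hx).trans_lt hk, hδ⟩

/-! ### The function `a⁺` -/

theorem aPlus_mem_image (t : orbits) (n : ℕ) :
    ∃ x, xStar α ≤ x ∧ fibreIter α β σ (t.1 (-(n : ℤ))) n x = aPlus α β σ t := by
  have : aPlus α β σ t ∈ pullbackSet α β σ t := by
    rw [pullbackSet_eq hα hS t]
    rfl
  exact Set.mem_iInter.mp this n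

/-- Going back one step further makes the starting point bounded: a single fibre map sends `[x*, ∞)`
into the trapping interval. -/
theorem aPlus_mem_image_trap (t : orbits) (n : ℕ) :
    ∃ x ∈ trap α β σ, fibreIter α β σ (t.1 (-(n : ℤ))) n x = aPlus α β σ t := by
  obtain ⟨x, hx, h⟩ := aPlus_mem_image hα hS t (n + 1)
  refine ⟨_, forcedFibre_mem hα hS (t.1 (-((n + 1 : ℕ) : ℤ))) hx, ?_⟩
  rw [← h, fibreIter_succ', ← t.2 (-((n + 1 : ℕ) : ℤ)),
    show -((n + 1 : ℕ) : ℤ) + 1 = -(n : ℤ) by push_cast; ring]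
  rfl

theorem aPlus_mem_trap (t : orbits) : aPlus α β σ t ∈ trap α β σ := by
  obtain ⟨x, hx, h⟩ := aPlus_mem_image_trap hα hS t 0
  rw [← h]
  exact hx

theorem tendsto_aPlus (t : orbits) :
    Tendsto (fun n : ℕ => fibreIter α β σ (t.1 (-(n : ℤ))) n (xStar α)) atTop
      (𝓝 (aPlus α β σ t)) := by
  refine tendsto_iff_norm_sub_tendsto_zero.mpr (squeeze_zero (fun _ => norm_nonneg _) (fun n => ?_)
    (tendsto_increment_iterate hα (sub_nonneg.mpr (xStar_mem_trap hα hS).2)))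
  obtain ⟨x, hx, h⟩ := aPlus_mem_image_trap hα hS t n
  rw [← h, norm_sub_rev, Real.norm_eq_abs]
  exact abs_fibreIter_sub_le hα hS _ n hx

/-- The choice that defines `aPlus` says nothing about measurability; it comes from the pullback
limit, whose terms are continuous functions of one coordinate. -/
theorem measurable_aPlus : Measurable (aPlus α β σ) :=
  measurable_of_tendsto_metrizable
    (fun n => (continuous_fibreIter_base α β σ n (xStar α)).measurable.comp
      (measurable_orbit_apply (-(n : ℤ))))
    (tendsto_pi_nhds.mpr fun t => tendsto_aPlus hα hS t)

end SPlus

/-- The shift on the space of two-sided orbits. -/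
def shift (t : orbits) : orbits := ⟨fun i => t.1 (i + 1), fun i => t.2 (i + 1)⟩

instance : IsProbabilityMeasure orbitMeasure := orbitMeasure_spec.1

theorem measurable_shift : Measurable shift :=
  Measurable.subtype_mk (measurable_pi_lambda _ fun i => measurable_orbit_apply (i + 1))

/-- The shift only permutes the marginals, which all coincide, and the marginals determine the
measure. -/
theorem map_shift_orbitMeasure : orbitMeasure.map shift = orbitMeasure := by
  have : IsProbabilityMeasure (orbitMeasure.map shift) :=
    Measure.isProbabilityMeasure_map measurable_shift.aemeasurable
  refine orbitMeasure_unique _ _ (fun i => ?_) orbitMeasure_spec.2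
  rw [Measure.map_map (measurable_orbit_apply i) measurable_shift]
  exact orbitMeasure_spec.2 (i + 1)

/-! ### Empirical measures and Birkhoff averages -/

theorem integral_empirical (G : ℝ × Angle → ℝ × Angle) (p : ℝ × Angle) (N : ℕ)
    (h : BoundedContinuousFunction (ℝ × Angle) ℝ) :
    ∫ q, h q ∂(empirical G p N) = birkhoffAverage ℝ G h N p := by
  rw [empirical, integral_smul_measure, integral_finsetSum_measure]
  · simp [birkhoffAverage, birkhoffSum]
  · exact fun n _ => h.integrable _

theorem mem_measureBasin_iff {G : ℝ × Angle → ℝ × Angle} {μ : Measure (ℝ × Angle)}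
    {p : ℝ × Angle} : p ∈ measureBasin G μ ↔
      ∀ h : BoundedContinuousFunction (ℝ × Angle) ℝ,
        Tendsto (fun N : ℕ => birkhoffAverage ℝ G h N p) atTop (𝓝 (∫ q, h q ∂μ)) := by
  simp only [measureBasin, Set.mem_ofPred_eq, integral_empirical]

theorem tendsto_birkhoffAverage_iterate_sub (G : ℝ × Angle → ℝ × Angle)
    (h : BoundedContinuousFunction (ℝ × Angle) ℝ) (k : ℕ) (p : ℝ × Angle) :
    Tendsto (fun N : ℕ => birkhoffAverage ℝ G h N (G^[k] p) - birkhoffAverage ℝ G h N p) atTop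
      (𝓝 0) := by
  induction k with
  | zero => simp
  | succ k ih =>
    have h1 := tendsto_birkhoffAverage_apply_sub_birkhoffAverage ℝ (f := G) (g := h)
      (x := G^[k] p) (h.isBounded_range.subset (by rintro _ ⟨n, rfl⟩; exact ⟨_, rfl⟩))
    have h2 := h1.add ih
    rw [add_zero] at h2
    refine h2.congr fun N => ?_
    rw [Function.iterate_succ_apply']
    ring

theorem mem_measureBasin_of_iterate {G : ℝ × Angle → ℝ × Angle} {μ : Measure (ℝ × Angle)}
    {p : ℝ × Angle} {k : ℕ} (hp : G^[k] p ∈ measureBasin G μ) : p ∈ measureBasin G μ := by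
  rw [mem_measureBasin_iff] at hp ⊢
  intro h
  have := (hp h).sub (tendsto_birkhoffAverage_iterate_sub G h k p)
  simpa using this

/-- An invariant probability measure concentrated on the basin of `μ` is equal to `μ`. -/
theorem eq_of_ae_mem_measureBasin {G : ℝ × Angle → ℝ × Angle} (hG : Continuous G)
    {μ ν : Measure (ℝ × Angle)} [IsProbabilityMeasure μ] [IsProbabilityMeasure ν]
    (hν : MeasurePreserving G ν ν) (h : ∀ᵐ p ∂ν, p ∈ measureBasin G μ) : ν = μ := by
  refine ext_of_forall_integral_eq_of_IsFiniteMeasure fun f => ?_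
  have hcont : ∀ n : ℕ, Continuous fun p => f (G^[n] p) := fun n =>
    f.continuous.comp (hG.iterate n)
  have hint : ∀ n : ℕ, Integrable (fun p => f (G^[n] p)) ν := fun n =>
    (hν.iterate n).integrable_comp_of_integrable (f.integrable ν)
  have hn : ∀ n : ℕ, ∫ p, f (G^[n] p) ∂ν = ∫ p, f p ∂ν := fun n =>
    ((integral_map (hν.iterate n).measurable.aemeasurable
      f.continuous.aestronglyMeasurable).symm.trans (by rw [(hν.iterate n).map_eq]))
  -- Invariance keeps the integral of the averages constant, while dominated convergence sends it to
  -- `∫ f dμ`. The average for `N = 0` is zero and is excluded.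
  have havg : ∀ N : ℕ, 1 ≤ N → ∫ p, birkhoffAverage ℝ G f N p ∂ν = ∫ p, f p ∂ν := by
    intro N hN
    have hN0 : (N : ℝ) ≠ 0 := by exact_mod_cast (by omega : N ≠ 0)
    simp only [birkhoffAverage, birkhoffSum, smul_eq_mul]
    rw [integral_const_mul, integral_finsetSum _ fun n _ => hint n]
    simp [hn, hN0]
  have hdom : Tendsto (fun N : ℕ => ∫ p, birkhoffAverage ℝ G f N p ∂ν) atTop
      (𝓝 (∫ _, (∫ q, f q ∂μ) ∂ν)) := by
    refine tendsto_integral_of_dominated_convergence (fun _ => ‖f‖) (fun N => ?_)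
      (integrable_const _) (fun N => Eventually.of_forall fun p => ?_) ?_
    · have : Continuous fun p => (N : ℝ)⁻¹ * ∑ n ∈ Finset.range N, f (G^[n] p) :=
        continuous_const.mul (continuous_finsetSum _ fun n _ => hcont n)
      exact this.aestronglyMeasurable
    · exact norm_average_le (norm_nonneg f) (fun n => f.norm_coe_le_norm _) N
    · filter_upwards [h] with p hp
      exact mem_measureBasin_iff.mp hp f
  rw [integral_const, probReal_univ, one_smul] at hdom
  refine tendsto_nhds_unique (tendsto_const_nhds.congr' ?_) hdom
  filter_upwards [eventually_ge_atTop 1] with N hN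
  exact (havg N hN).symm

theorem Equidistributed.iterate {θ : Angle} (hθ : Equidistributed θ) (k : ℕ) :
    Equidistributed (tripling^[k] θ) := by
  induction k with
  | zero => exact hθ
  | succ k ih =>
    intro φ hφ
    have hb : Bornology.IsBounded (Set.range φ) := (isCompact_range hφ).isBounded
    have := (tendsto_birkhoffAverage_apply_sub_birkhoffAverage' ℝ hb tripling
      (tripling^[k] θ)).add (ih φ hφ)
    rw [zero_add] at this
    refine this.congr fun N => ?_
    rw [Function.iterate_succ_apply']
    simp only [birkhoffAverage, birkhoffSum, smul_eq_mul, sub_add_cancel]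

section SPlus

variable {α β σ : ℝ} (hα : 1 < α) (hS : (β, σ) ∈ SPlus α)

include hα hS

/-! ### Invariance of `μ⁺` -/

/-- The image of `a⁺(t)` lies in every set of the intersection for the shifted orbit, which is a
singleton. This equivariance makes `μ⁺` invariant. -/
theorem aPlus_shift (t : orbits) :
    aPlus α β σ (shift t) = forcedFibre α β σ (t.1 0) (aPlus α β σ t) := by
  have : forcedFibre α β σ (t.1 0) (aPlus α β σ t) ∈ pullbackSet α β σ (shift t) := by
    refine Set.mem_iInter.mpr fun n => ?_
    cases n with
    | zero => exact ⟨_, (forcedFibre_mem hα hS _ (aPlus_mem_trap hα hS t).1).1, rfl⟩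
    | succ n =>
      obtain ⟨x, hx, h⟩ := aPlus_mem_image hα hS t n
      refine ⟨x, hx, ?_⟩
      have h1 : (shift t).1 (-((n + 1 : ℕ) : ℤ)) = t.1 (-(n : ℤ)) := by
        show t.1 (-((n + 1 : ℕ) : ℤ) + 1) = t.1 (-(n : ℤ))
        rw [show -((n + 1 : ℕ) : ℤ) + 1 = -(n : ℤ) by push_cast; ring]
      have h2 : tripling^[n] (t.1 (-(n : ℤ))) = t.1 0 := by
        rw [← orbit_apply_add t.2, neg_add_cancel]
      rw [h1, fibreIter, Function.comp_apply, h, h2]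
  rw [pullbackSet_eq hα hS] at this
  exact this.symm

theorem measurable_aPlus_prod : Measurable fun t : orbits => (aPlus α β σ t, t.1 0) :=
  (measurable_aPlus hα hS).prodMk (measurable_orbit_apply 0)

theorem isProbabilityMeasure_muPlus : IsProbabilityMeasure (muPlus α β σ) :=
  Measure.isProbabilityMeasure_map (measurable_aPlus_prod hα hS).aemeasurable

theorem map_snd_muPlus : (muPlus α β σ).map Prod.snd = angleMeasure := by
  rw [muPlus, Measure.map_map measurable_snd (measurable_aPlus_prod hα hS)]
  exact orbitMeasure_spec.2 0

theorem measurePreserving_skew : MeasurePreserving (skew α β σ) (muPlus α β σ) (muPlus α β σ) := by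
  refine ⟨(continuous_skew α β σ).measurable, ?_⟩
  conv_rhs => rw [muPlus, ← map_shift_orbitMeasure]
  rw [Measure.map_map (measurable_aPlus_prod hα hS) measurable_shift, muPlus,
    Measure.map_map (continuous_skew α β σ).measurable (measurable_aPlus_prod hα hS)]
  congr 1
  funext t
  simp only [Function.comp, aPlus_shift hα hS]
  exact Prod.ext rfl (t.2 0).symm

theorem ae_mem_trap_muPlus : ∀ᵐ p ∂(muPlus α β σ), p.1 ∈ trap α β σ := by
  have hm : MeasurableSet {p : ℝ × Angle | p.1 ∈ trap α β σ} := measurable_fst measurableSet_Icc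
  exact (ae_map_iff (measurable_aPlus_prod hα hS).aemeasurable hm).mpr
    (Eventually.of_forall fun t => aPlus_mem_trap hα hS t)

/-! ### The basin of `μ⁺` -/

/-- Invariance replaces `h` by `h ∘ G^k`, and the marginal turns the integral over the circle into
one against `μ⁺`; the integrands then differ by at most `ε` on the trap. -/
theorem abs_integral_muPlus_sub_le (h : BoundedContinuousFunction (ℝ × Angle) ℝ) {ε : ℝ} {k : ℕ}
    (hk : ∀ x ∈ trap α β σ, ∀ θ : Angle,
      |h ((skew α β σ)^[k] (x, θ)) - h ((skew α β σ)^[k] (xStar α, θ))| ≤ ε) :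
    |∫ q, h q ∂(muPlus α β σ) - ∫ θ, h ((skew α β σ)^[k] (xStar α, θ)) ∂angleMeasure| ≤ ε := by
  have := isProbabilityMeasure_muPlus hα hS
  have hG := (continuous_skew α β σ).iterate k
  have hpres := (measurePreserving_skew hα hS).iterate k
  have e1 : ∫ q, h q ∂(muPlus α β σ) = ∫ q, h ((skew α β σ)^[k] q) ∂(muPlus α β σ) := by
    conv_lhs => rw [← hpres.map_eq]
    exact integral_map hpres.measurable.aemeasurable h.continuous.aestronglyMeasurable
  have e2 : ∫ θ, h ((skew α β σ)^[k] (xStar α, θ)) ∂angleMeasure =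
      ∫ q, h ((skew α β σ)^[k] (xStar α, q.2)) ∂(muPlus α β σ) := by
    rw [← map_snd_muPlus hα hS]
    exact integral_map measurable_snd.aemeasurable
      (h.continuous.comp (hG.comp (Continuous.prodMk_right _))).aestronglyMeasurable
  have i1 : Integrable (fun q => h ((skew α β σ)^[k] q)) (muPlus α β σ) :=
    (h.compContinuous ⟨_, hG⟩).integrable _
  have i2 : Integrable (fun q : ℝ × Angle => h ((skew α β σ)^[k] (xStar α, q.2)))
      (muPlus α β σ) :=
    (h.compContinuous ⟨_, hG.comp ((Continuous.prodMk_right (xStar α)).comp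
      continuous_snd)⟩).integrable _
  rw [e1, e2, ← integral_sub i1 i2, ← Real.norm_eq_abs]
  refine (norm_integral_le_of_norm_le_const (C := ε) ?_).trans (by simp)
  filter_upwards [ae_mem_trap_muPlus hα hS] with p hp
  exact hk p.1 hp p.2

theorem mem_measureBasin_of_mem_trap {x : ℝ} {θ : Angle} (hx : x ∈ trap α β σ)
    (hθ : Equidistributed θ) : (x, θ) ∈ measureBasin (skew α β σ) (muPlus α β σ) := by
  refine mem_measureBasin_iff.mpr fun h => Metric.tendsto_atTop.mpr fun ε hε => ?_
  obtain ⟨k, hk⟩ := exists_forall_abs_sub_le hα hS h.continuous (show 0 < ε / 4 by positivity)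
  have h1 := abs_integral_muPlus_sub_le hα hS h hk
  have hφ : Continuous fun s => h ((skew α β σ)^[k] (xStar α, s)) :=
    h.continuous.comp (((continuous_skew α β σ).iterate k).comp (Continuous.prodMk_right _))
  obtain ⟨N₁, hN₁⟩ := Metric.tendsto_atTop.mp (hθ _ hφ) (ε / 4) (by positivity)
  obtain ⟨N₂, hN₂⟩ := Metric.tendsto_atTop.mp
    (tendsto_birkhoffAverage_iterate_sub (skew α β σ) h k (x, θ)) (ε / 4) (by positivity)
  refine ⟨max N₁ N₂, fun N hN => ?_⟩
  have h2 := hN₁ N (le_of_max_le_left hN)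
  have h3 := hN₂ N (le_of_max_le_right hN)
  have h4 : |birkhoffAverage ℝ (skew α β σ) h N ((skew α β σ)^[k] (x, θ)) - (N : ℝ)⁻¹ *
      ∑ n ∈ Finset.range N, h ((skew α β σ)^[k] (xStar α, tripling^[n] θ))| ≤ ε / 4 := by
    rw [birkhoffAverage, birkhoffSum, smul_eq_mul, ← mul_sub, ← Finset.sum_sub_distrib,
      ← smul_eq_mul, ← Real.norm_eq_abs]
    refine norm_average_le (by positivity) (fun n => ?_) N
    -- The `k` steps are performed last, so that the contraction estimate applies from the `n`-th
    -- point of the trajectory.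
    rw [← Function.iterate_add_apply, add_comm, Function.iterate_add_apply, skew_iterate _ _ _ n]
    exact hk _ (fibreIter_mem_trap hα hS θ n hx) _
  rw [Real.dist_eq] at h2 h3 ⊢
  rw [sub_zero] at h3
  rw [abs_lt] at *
  rw [abs_le] at *
  constructor <;> linarith [h1.1, h1.2, h2.1, h2.2, h3.1, h3.2, h4.1, h4.2]

theorem mem_measureBasin_of_le_fibreIter {x : ℝ} {θ : Angle} {n : ℕ}
    (hx : xStar α ≤ fibreIter α β σ θ n x) (hθ : Equidistributed θ) :
    (x, θ) ∈ measureBasin (skew α β σ) (muPlus α β σ) := by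
  -- One step beyond time `n` also brings the point below the upper end of the trap.
  refine mem_measureBasin_of_iterate (k := n + 1) ?_
  rw [skew_iterate]
  exact mem_measureBasin_of_mem_trap hα hS (forcedFibre_mem hα hS _ hx) (hθ.iterate _)

end SPlus

instance : angleMeasure.IsOpenPosMeasure :=
  inferInstanceAs ((AddCircle.haarAddCircle (T := 2 * Real.pi)).IsOpenPosMeasure)

/-! ### Trajectories that start below `x*` -/

/-- The Cesàro means tend both to `0` and to `∫ φ`; a nonnegative continuous function with zero
integral vanishes because the measure has full support. -/
theorem Equidistributed.eq_zero {θ : Angle} (hθ : Equidistributed θ) {φ : Angle → ℝ}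
    (hφ : Continuous φ) (h0 : ∀ s, 0 ≤ φ s)
    (hlim : Tendsto (fun n : ℕ => φ (tripling^[n] θ)) atTop (𝓝 0)) (s : Angle) : φ s = 0 := by
  have h1 : ∫ s, φ s ∂angleMeasure = 0 := tendsto_nhds_unique (hθ φ hφ) hlim.cesaro
  have h2 := (integral_eq_zero_iff_of_nonneg h0 (integrable_of_continuous hφ)).mp h1
  exact congrFun ((hφ.ae_eq_iff_eq angleMeasure continuous_zero).mp h2) s

theorem xStar_pos {α : ℝ} (hα : 1 < α) : 0 < xStar α := Real.sqrt_pos.mpr (by linarith)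

/-- On `[-x*, ∞)` the displacement `α arctan y - y` is maximal at `x*`: its derivative is
nonnegative on `[-x*, x*]`, and beyond `x*` the bound is `increment_lt`. -/
theorem arctan_sub_le_betaStar {α y : ℝ} (hα : 1 < α) (hy : -xStar α ≤ y) :
    α * Real.arctan y - y ≤ betaStar α := by
  rcases le_total y (xStar α) with h | h
  · have hd : ∀ x : ℝ, HasDerivAt (fun x => α * Real.arctan x - x) (α * (1 / (1 + x ^ 2)) - 1) x :=
      fun x => ((Real.hasDerivAt_arctan x).const_mul α).sub (hasDerivAt_id x)
    have hm : MonotoneOn (fun x => α * Real.arctan x - x) (Set.Icc (-xStar α) (xStar α)) := by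
      refine monotoneOn_of_deriv_nonneg (convex_Icc _ _)
        (fun x _ => (hd x).continuousAt.continuousWithinAt)
        (fun x _ => (hd x).differentiableAt.differentiableWithinAt) fun x hx => ?_
      rw [interior_Icc] at hx
      have hsq : xStar α ^ 2 = α - 1 := Real.sq_sqrt (by linarith)
      rw [(hd x).deriv, mul_one_div, sub_nonneg, le_div_iff₀ (by positivity)]
      nlinarith [hx.1, hx.2]
    exact hm ⟨hy, h⟩ ⟨by linarith [xStar_pos hα], le_rfl⟩ h
  · rcases h.eq_or_lt with rfl | h
    · exact le_rfl
    · have := increment_lt hα (sub_pos.mpr h)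
      rw [increment, add_sub_cancel] at this
      rw [betaStar]
      linarith

theorem neg_betaStar_le_arctan_sub {α y : ℝ} (hα : 1 < α) (hy : y ≤ xStar α) :
    -betaStar α ≤ α * Real.arctan y - y := by
  have := arctan_sub_le_betaStar hα (neg_le_neg hy)
  rw [Real.arctan_neg] at this
  linarith

theorem fibreIter_succ_apply (α β σ : ℝ) (θ : Angle) (n : ℕ) (x : ℝ) :
    fibreIter α β σ θ (n + 1) x = α * Real.arctan (fibreIter α β σ θ n x) +
      (β + σ * cosine (tripling^[n] θ)) := rfl

/-- Convergence of the trajectory forces `σ cos` to converge along an equidistributed orbit, hence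
to be constant. The values at `0` and `π` give `σ = 0` and then `β = -β*`, for which no step
starting above `-x*` goes up. -/
theorem not_tendsto_xStar_of_lt {α β σ : ℝ} (hα : 1 < α) {θ : Angle} (hθ : Equidistributed θ)
    {x : ℝ} (hlt : ∀ n, fibreIter α β σ θ n x < xStar α) :
    ¬ Tendsto (fun n => fibreIter α β σ θ n x) atTop (𝓝 (xStar α)) := by
  intro hy
  set y : ℕ → ℝ := fun n => fibreIter α β σ θ n x with hydef
  set c := xStar α - α * Real.arctan (xStar α) - β with hc
  have hcos : Tendsto (fun n => σ * cosine (tripling^[n] θ)) atTop (𝓝 c) := by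
    have h1 := ((hy.comp (tendsto_add_atTop_nat 1)).sub
      (((Real.continuous_arctan.tendsto _).comp hy).const_mul α)).sub_const β
    refine h1.congr fun n => ?_
    simp only [Function.comp, hydef, fibreIter_succ_apply]
    ring
  have hφ := hθ.eq_zero (φ := fun s => (σ * cosine s - c) ^ 2)
    (((continuous_const.mul continuous_cosine).sub continuous_const).pow 2)
    (fun s => sq_nonneg _) (by simpa using (hcos.sub_const c).pow 2)
  have h0 := pow_eq_zero_iff (two_ne_zero) |>.mp (hφ ((0 : ℝ) : Angle))
  have hpi := pow_eq_zero_iff (two_ne_zero) |>.mp (hφ ((Real.pi : ℝ) : Angle))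
  have e0 : cosine ((0 : ℝ) : Angle) = 1 := Real.cos_zero
  have epi : cosine ((Real.pi : ℝ) : Angle) = -1 := Real.cos_pi
  rw [e0] at h0
  rw [epi] at hpi
  have hσ : σ = 0 := by linarith
  have hβ : β = -betaStar α := by
    rw [betaStar]
    linarith
  obtain ⟨n₀, hn₀⟩ := eventually_atTop.mp
    (hy.eventually (lt_mem_nhds (show -xStar α < xStar α by linarith [xStar_pos hα])))
  have hanti : ∀ n ≥ n₀, y n ≤ y n₀ := by
    intro n hn
    induction n, hn using Nat.le_induction with
    | base => exact le_rfl
    | succ n hn ih =>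
      have := arctan_sub_le_betaStar hα (hn₀ n hn).le
      have h2 : y (n + 1) = α * Real.arctan (y n) + (β + σ * cosine (tripling^[n] θ)) := rfl
      rw [hσ, hβ] at h2
      linarith
  have := le_of_tendsto hy (eventually_atTop.mpr ⟨n₀, hanti⟩)
  exact (hlt n₀).not_ge this

/-- Below `x*` the unforced displacement is at least `-β*`, so a step gains at least `η` whenever
the forcing exceeds `β* + η`. Near the fixed angle `0` this happens many times in a row. -/
theorem exists_xStar_le_fibreIter_of_betaStar_lt {α β σ : ℝ} (hα : 1 < α) (hσ : 0 ≤ σ)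
    (h : betaStar α < β + σ) {θ : Angle} (hθ : Equidistributed θ) (x : ℝ) :
    ∃ n, xStar α ≤ fibreIter α β σ θ n x := by
  by_contra! hlt
  set η := (β + σ - betaStar α) / 2 with hη
  have hη0 : 0 < η := by rw [hη]; linarith
  -- `L` bounds every image from below, wherever the trajectory started; hence times are counted
  -- from `n + 1`, and `m` gains of `η` suffice to climb from `L` to `x*`.
  set L := α * (-(Real.pi / 2)) + (β - σ) with hL
  have hlow : ∀ n, L ≤ fibreIter α β σ θ (n + 1) x := by
    intro n
    rw [fibreIter_succ_apply, hL]
    have h1 := (Real.neg_pi_div_two_lt_arctan (fibreIter α β σ θ n x)).le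
    have h2 := (abs_le.mp (abs_cosine_le (tripling^[n] θ))).1
    nlinarith
  obtain ⟨m, hm⟩ := exists_nat_ge ((xStar α - L) / η)
  rw [div_le_iff₀ hη0] at hm
  -- A continuous bump that is nonzero exactly where `m` successive forcings all exceed `β* + η`. It
  -- is positive at `0`, so an equidistributed orbit must meet its support.
  let φ : Angle → ℝ := fun s => ∏ i ∈ Finset.range m,
    max 0 (β + σ * cosine (tripling^[i] s) - betaStar α - η)
  have hφ : Continuous φ := continuous_finsetProd _ fun i _ =>
    continuous_const.max (((continuous_const.add (continuous_const.mul
      (continuous_cosine.comp (continuous_tripling.iterate i)))).sub continuous_const).sub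
      continuous_const)
  have hφ0 : φ 0 ≠ 0 := by
    refine Finset.prod_ne_zero_iff.mpr fun i _ => ?_
    have e0 : cosine 0 = 1 := Real.cos_zero
    rw [tripling_iterate, smul_zero, e0]
    exact (lt_max_of_lt_right (by rw [hη]; linarith)).ne'
  have hvisit : ∃ n, φ (tripling^[n + 1] θ) ≠ 0 := by
    by_contra! hall
    refine hφ0 ((hθ.iterate 1).eq_zero hφ
      (fun s => Finset.prod_nonneg fun i _ => le_max_left _ _) ?_ 0)
    refine tendsto_const_nhds.congr fun n => ?_
    rw [← Function.iterate_add_apply, hall]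
  obtain ⟨n, hn⟩ := hvisit
  have hstep : ∀ i ≤ m, L + i * η ≤ fibreIter α β σ θ (n + 1 + i) x := by
    intro i
    induction i with
    | zero => simpa using hlow n
    | succ i ih =>
      intro hi
      have h1 := ih (by omega)
      have h2 := neg_betaStar_le_arctan_sub hα (hlt (n + 1 + i)).le
      have h3 := Finset.prod_ne_zero_iff.mp hn i (Finset.mem_range.mpr (by omega))
      have h4 : 0 < β + σ * cosine (tripling^[i] (tripling^[n + 1] θ)) - betaStar α - η := by
        by_contra! hle
        exact h3 (max_eq_left hle)
      rw [← Function.iterate_add_apply, add_comm i] at h4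
      rw [← add_assoc, fibreIter_succ_apply]
      push_cast
      linarith
  have := hstep m le_rfl
  have := hlt (n + 1 + m)
  linarith

/-! ### Attraction to `𝒜⁺`, physicality, uniqueness and ergodicity -/

section SPlus

variable {α β σ : ℝ} (hα : 1 < α) (hS : (β, σ) ∈ SPlus α)

include hα hS

theorem attractorPlus_subset : attractorPlus α β σ ⊆ Set.Ici (xStar α) ×ˢ Set.univ := by
  refine Measure.support_subset_of_isClosed (isClosed_Ici.prod isClosed_univ) ?_
  filter_upwards [ae_mem_trap_muPlus hα hS] with p hp
  exact ⟨hp.1, trivial⟩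

theorem attractorPlus_nonempty : (attractorPlus α β σ).Nonempty :=
  have := isProbabilityMeasure_muPlus hα hS
  Measure.nonempty_support (IsProbabilityMeasure.ne_zero _)

/-- Since `𝒜⁺` lies in `x ≥ x*`, a point below `x*` is at least as far from `𝒜⁺` as its height is
from `x*`. A trajectory that stays below would therefore converge to `x*`. -/
theorem exists_xStar_le_fibreIter_of_mem_basin {x : ℝ} {θ : Angle} (hθ : Equidistributed θ)
    (hx : (x, θ) ∈ basin (skew α β σ) (attractorPlus α β σ)) :
    ∃ n, xStar α ≤ fibreIter α β σ θ n x := by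
  by_contra! hlt
  refine not_tendsto_xStar_of_lt hα hθ hlt ?_
  rw [tendsto_iff_dist_tendsto_zero]
  refine squeeze_zero (fun _ => dist_nonneg) (fun n => ?_) hx
  refine (Metric.le_infDist (attractorPlus_nonempty hα hS)).mpr fun q hq => ?_
  have h1 : xStar α ≤ q.1 := (attractorPlus_subset hα hS hq).1
  rw [skew_iterate, Real.dist_eq, abs_of_neg (sub_neg.mpr (hlt n))]
  refine le_trans ?_ (le_max_left _ _)
  rw [Real.dist_eq]
  exact le_trans (by linarith) (neg_le_abs _)

theorem measureBasin_muPlus_pos : 0 < volume (measureBasin (skew α β σ) (muPlus α β σ)) := by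
  have hsub : Set.Ici (xStar α) ×ˢ {θ | Equidistributed θ} ⊆
      measureBasin (skew α β σ) (muPlus α β σ) := fun p hp =>
    mem_measureBasin_of_le_fibreIter hα hS (n := 0) hp.1 hp.2
  refine lt_of_lt_of_le ?_ (measure_mono hsub)
  have hne : volume {θ : Angle | Equidistributed θ} ≠ 0 := by
    intro h0
    rw [AddCircle.volume_eq_smul_haarAddCircle, Measure.smul_apply, smul_eq_mul, mul_eq_zero] at h0
    have h1 : angleMeasure {θ : Angle | Equidistributed θ} = 0 :=
      h0.resolve_left (by simpa using Real.pi_pos)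
    obtain ⟨θ, hθ, hθ'⟩ := ((measure_eq_zero_iff_ae_notMem.mp h1).and ae_equidistributed).exists
    exact hθ hθ'
  rw [Measure.volume_eq_prod, Measure.prod_prod, Real.volume_Ici]
  exact ENNReal.mul_pos ENNReal.top_ne_zero hne

theorem eq_muPlus_of_ae_xStar_le {ν : Measure (ℝ × Angle)} [IsProbabilityMeasure ν]
    (hν : MeasurePreserving (skew α β σ) ν ν) (hmarg : ν.map Prod.snd = angleMeasure)
    (h : ∀ᵐ p ∂ν, Equidistributed p.2 → ∃ n, xStar α ≤ fibreIter α β σ p.2 n p.1) :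
    ν = muPlus α β σ := by
  have := isProbabilityMeasure_muPlus hα hS
  refine eq_of_ae_mem_measureBasin (continuous_skew α β σ) hν ?_
  have he : ∀ᵐ p ∂ν, Equidistributed p.2 :=
    ae_of_ae_map measurable_snd.aemeasurable (hmarg ▸ ae_equidistributed)
  filter_upwards [h, he] with p hp hp2
  obtain ⟨n, hn⟩ := hp hp2
  exact mem_measureBasin_of_le_fibreIter hα hS hn hp2

theorem ae_mem_measureBasin_muPlus :
    ∀ᵐ p ∂(muPlus α β σ), p ∈ measureBasin (skew α β σ) (muPlus α β σ) := by
  have he : ∀ᵐ p ∂(muPlus α β σ), Equidistributed p.2 :=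
    ae_of_ae_map measurable_snd.aemeasurable ((map_snd_muPlus hα hS) ▸ ae_equidistributed)
  filter_upwards [ae_mem_trap_muPlus hα hS, he] with p hp hp2
  exact mem_measureBasin_of_mem_trap hα hS hp hp2

/-- Conditioning `μ⁺` on an invariant set of positive measure gives an invariant probability measure
concentrated on the basin of `μ⁺`, hence `μ⁺` itself; so the complement is null. -/
theorem ergodic_muPlus : Ergodic (skew α β σ) (muPlus α β σ) := by
  have := isProbabilityMeasure_muPlus hα hS
  have hpres := measurePreserving_skew hα hS
  refine ⟨hpres, ⟨fun s hs hinv => ?_⟩⟩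
  rw [eventuallyConst_set']
  by_cases h0 : muPlus α β σ s = 0
  · exact Or.inl (ae_eq_empty.mpr h0)
  · refine Or.inr (ae_eq_univ.mpr ?_)
    have hp : IsProbabilityMeasure (ProbabilityTheory.cond (muPlus α β σ) s) :=
      ProbabilityTheory.cond_isProbabilityMeasure h0
    have hr := hpres.restrict_preimage hs
    rw [hinv] at hr
    have hν : MeasurePreserving (skew α β σ) (ProbabilityTheory.cond (muPlus α β σ) s)
        (ProbabilityTheory.cond (muPlus α β σ) s) := hr.smul_measure _
    have heq := eq_of_ae_mem_measureBasin (continuous_skew α β σ) hν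
      (ProbabilityTheory.cond_absolutelyContinuous.ae_le (ae_mem_measureBasin_muPlus hα hS))
    rw [← heq, ProbabilityTheory.cond_apply hs, Set.inter_compl_self, measure_empty, mul_zero]

end SPlus

end

end ForcedArctan

theorem propositionA3 (α β σ : ℝ) (hα : 1 < α) (hS : (β, σ) ∈ ForcedArctan.SPlus α) :
    -- almost every angle is good: over it, the basin of the set lies in the basin of the measure
    (∃ R : Set ForcedArctan.Angle, MeasurableSet R ∧ ForcedArctan.angleMeasure Rᶜ = 0 ∧
      ∀ (x : ℝ) (θ : ForcedArctan.Angle), θ ∈ R →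
        (x, θ) ∈ ForcedArctan.basin (ForcedArctan.skew α β σ)
          (ForcedArctan.attractorPlus α β σ) →
        (x, θ) ∈ ForcedArctan.measureBasin (ForcedArctan.skew α β σ)
          (ForcedArctan.muPlus α β σ)) ∧
    ForcedArctan.IsPhysical (ForcedArctan.skew α β σ) (ForcedArctan.muPlus α β σ) ∧
    -- the measure is ergodic, with the stated marginal and support
    (Ergodic (ForcedArctan.skew α β σ) (ForcedArctan.muPlus α β σ) ∧
      (ForcedArctan.muPlus α β σ).map Prod.snd = ForcedArctan.angleMeasure ∧
      (ForcedArctan.muPlus α β σ).support ⊆ Set.Ici (ForcedArctan.xStar α) ×ˢ Set.univ) ∧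
    -- uniqueness among the measures supported in `x ≥ x*`
    (∀ ν : Measure (ℝ × ForcedArctan.Angle), IsProbabilityMeasure ν →
      MeasurePreserving (ForcedArctan.skew α β σ) ν ν →
      ν.map Prod.snd = ForcedArctan.angleMeasure →
      ν.support ⊆ Set.Ici (ForcedArctan.xStar α) ×ˢ Set.univ →
      ν = ForcedArctan.muPlus α β σ) ∧
    -- uniqueness among all measures, outside the region `A`
    ((β, σ) ∉ ForcedArctan.regionA α →
      ∀ ν : Measure (ℝ × ForcedArctan.Angle), IsProbabilityMeasure ν →
        MeasurePreserving (ForcedArctan.skew α β σ) ν ν →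
        ν.map Prod.snd = ForcedArctan.angleMeasure →
        ν = ForcedArctan.muPlus α β σ) := by
  refine ⟨?_, ⟨ForcedArctan.isProbabilityMeasure_muPlus hα hS,
    ForcedArctan.measurePreserving_skew hα hS, ForcedArctan.measureBasin_muPlus_pos hα hS⟩,
    ⟨ForcedArctan.ergodic_muPlus hα hS, ForcedArctan.map_snd_muPlus hα hS,
    ForcedArctan.attractorPlus_subset hα hS⟩, fun ν hν hinv hmarg hsupp => ?_,
    fun hA ν hν hinv hmarg => ?_⟩
  -- Measurability of the set of equidistributed angles is never established, so `R` is the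
  -- complement of a measurable null set that contains all the other angles.
  · obtain ⟨N, hN, hNm, hN0⟩ := exists_measurable_superset_of_null
      (ae_iff.mp ForcedArctan.ae_equidistributed)
    refine ⟨Nᶜ, hNm.compl, by rwa [compl_compl], fun x θ hθ hx => ?_⟩
    have hE : ForcedArctan.Equidistributed θ := by
      by_contra hE
      exact hθ (hN hE)
    obtain ⟨n, hn⟩ := ForcedArctan.exists_xStar_le_fibreIter_of_mem_basin hα hS hE hx
    exact ForcedArctan.mem_measureBasin_of_le_fibreIter hα hS hn hE
  · refine ForcedArctan.eq_muPlus_of_ae_xStar_le hα hS hinv hmarg ?_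
    filter_upwards [Measure.support_mem_ae (μ := ν)] with p hp _
    exact ⟨0, (hsupp hp).1⟩
  · have hlt : ForcedArctan.betaStar α < β + σ := by
      by_contra! hle
      exact hA ⟨hS, hS.1, hle⟩
    exact ForcedArctan.eq_muPlus_of_ae_xStar_le hα hS hinv hmarg (Eventually.of_forall fun p hp =>
      ForcedArctan.exists_xStar_le_fibreIter_of_betaStar_lt hα hS.1 hlt hp p.1)
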